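/- **Theorem (Convergence for fixed shapes).** Let $p:(0,1)\to[0,\infty)$ be a continuous probability density with finite log-moment $\int_0^1 p(t)\log(1/t)\,dt<\infty$. Let $\{p_n\}_{n\ge 1}$ be a sequence of probability mass functions, with $p_n$ supported on $\{1,\dots,n\}$, which strongly discretizes $p$: there are constants $\kappa>0$ and $C>0$ such that $$\int_0^1 |p_x(t)-p(t)|\,dt\le C x^{-\kappa}\quad\text{for all real } x\ge C,\qquad\text{where } p_x(t)= x\,p_{\lfloor x\rfloor}(\lceil tx\rceil)\ \text{ for } t\in(0,1).$$ Let $d$ be a natural number, let $k\ge 1$ be an integer, and let $\{a_n\}_{n\ge1}$ be a sequence in $\mathbb{R}^d$ such that $$a_{n+1}=\mathbb{E}_{j\sim p_n}[a_j]=\sum_{j=1}^n p_n(j)\,a_j\quad\text{for all } n\ge k.$$ Then the sequence $\{a_n\}_{n\ge1}$ converges. -/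

import Mathlib

open MeasureTheory Filter Topology Set

/-- `p` restricts to a continuous probability density on the open interval `(0, 1)`, with values
in `[0, ∞)`.  Values of `p` outside `(0, 1)` are irrelevant. -/
structure IsContinuousDensity (p : ℝ → ℝ) : Prop where
  continuousOn : ContinuousOn p (Ioo 0 1)
  nonneg : ∀ t ∈ Ioo (0 : ℝ) 1, 0 ≤ p t
  integrableOn : IntegrableOn p (Ioo 0 1)
  integral_eq_one : ∫ t in Ioo (0 : ℝ) 1, p t = 1

/-- The rescaled step density `p_x(t) = x * p_{⌊x⌋}(⌈t x⌉)` attached to a sequence `q` of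
probability mass functions. -/
noncomputable def stepDensity (q : ℕ → PMF ℕ) (x t : ℝ) : ℝ :=
  x * (q ⌊x⌋₊ ⌈t * x⌉₊).toReal

/-- The sequence `q` strongly discretizes `p`: there are `κ > 0` and `C > 0` such that
`‖p_x - p‖₁ ≤ C x ^ (-κ)` in `L¹(0, 1)` for all real `x ≥ C`.  (Since `C` may always be enlarged,
the meaningless term `q 0` plays no role.) -/
def StronglyDiscretizes (q : ℕ → PMF ℕ) (p : ℝ → ℝ) : Prop :=
  ∃ κ C : ℝ, 0 < κ ∧ 0 < C ∧ ∀ x : ℝ, C ≤ x →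
    eLpNorm (fun t => stepDensity q x t - p t) 1 (volume.restrict (Ioo 0 1)) ≤
      ENNReal.ofReal (C * x ^ (-κ))

/-! Work coordinatewise and pass to logarithmic time: with `φ s = b (⌊exp s⌋₊ + 1)` and `ν` the law
of `-log T`, where `T` has density `p`, strong discretization turns the recursion into `φ = ν * φ`
up to an error `O(exp (-κ s))`. The log-moment condition says that `ν` has finite mean `m`.

The error is integrable at infinity, so the charge `∫ (∫_{s-u}^s φ) dν(u)` converges to some `Q`
(`exists_tendsto_renewalCharge`). Let `M = limsup φ`. Then `Ψ = |M - φ|` satisfies `ν * Ψ ≤ Ψ +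
o(1)`, and `ν` dominates a multiple of Lebesgue measure on an interval. Smallness of `Ψ` at one late
point therefore spreads to arbitrarily long windows (`exists_window_integral_le`). On such windows
the charge is close to `M * m`, so `Q = M * m` (`renewalCharge_limit_eq`). The same argument for
`-φ` gives `Q = liminf φ * m`, and `m > 0` forces limsup and liminf to agree. -/

theorem Measurable.intervalIntegrable_of_abs_le {f : ℝ → ℝ} {B : ℝ} (hf : Measurable f)
    (hB : ∀ x, |f x| ≤ B) (a b : ℝ) : IntervalIntegrable f volume a b := by
  rw [intervalIntegrable_iff, uIoc]
  exact Integrable.of_bound hf.aestronglyMeasurable B (ae_of_all _ hB)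

/-! ### Approximate solutions of the renewal equation and their charge. -/

/-- A bounded measurable function `φ` on the line which satisfies the renewal equation
`φ = ν * φ` up to an exponentially small error. -/
structure IsRenewalSolution (ν : Measure ℝ) (φ : ℝ → ℝ) (B K κ S₀ : ℝ) : Prop where
  measurable : Measurable φ
  bound : ∀ s, |φ s| ≤ B
  rate_pos : 0 < κ
  small : ∀ s, S₀ ≤ s → |φ s - ∫ u, φ (s - u) ∂ν| ≤ K * Real.exp (-κ * s)

/-- The quantity `∫ (∫_{s-u}^s φ) dν(u)`, which is asymptotically conserved along solutions of the
renewal equation. -/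
noncomputable def renewalCharge (ν : Measure ℝ) (φ : ℝ → ℝ) (s : ℝ) : ℝ :=
  ∫ u, (∫ x in (s - u)..s, φ x) ∂ν

namespace IsRenewalSolution

variable {ν : Measure ℝ} {φ : ℝ → ℝ} {B K κ S₀ : ℝ}

theorem neg (h : IsRenewalSolution ν φ B K κ S₀) :
    IsRenewalSolution ν (fun s => -φ s) B K κ S₀ where
  measurable := h.measurable.neg
  bound s := by simpa using h.bound s
  rate_pos := h.rate_pos
  small s hs := by
    rw [integral_neg, ← neg_add', abs_neg]
    simpa [sub_eq_add_neg] using h.small s hs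

theorem intervalIntegrable (h : IsRenewalSolution ν φ B K κ S₀) (a b : ℝ) :
    IntervalIntegrable φ volume a b :=
  h.measurable.intervalIntegrable_of_abs_le h.bound a b

theorem integrable_comp_sub [IsFiniteMeasure ν] (h : IsRenewalSolution ν φ B K κ S₀) (s : ℝ) :
    Integrable (fun u => φ (s - u)) ν :=
  Integrable.of_bound (h.measurable.comp (measurable_const.sub measurable_id)).aestronglyMeasurable
    B (ae_of_all _ fun u => h.bound (s - u))

theorem measurable_integral_comp_sub [IsFiniteMeasure ν] (h : IsRenewalSolution ν φ B K κ S₀) :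
    Measurable (fun s => ∫ u, φ (s - u) ∂ν) := by
  have : StronglyMeasurable (Function.uncurry fun s u : ℝ => φ (s - u)) :=
    (h.measurable.comp (measurable_fst.sub measurable_snd)).stronglyMeasurable
  exact this.integral_prod_right.measurable

theorem abs_integral_comp_sub_le [IsProbabilityMeasure ν] (h : IsRenewalSolution ν φ B K κ S₀)
    (s : ℝ) : |∫ u, φ (s - u) ∂ν| ≤ B := by
  simpa using norm_integral_le_of_norm_le_const (μ := ν) (f := fun u => φ (s - u)) (C := B)
    (ae_of_all _ fun u => h.bound (s - u))

theorem continuous_primitive_sub (h : IsRenewalSolution ν φ B K κ S₀) (s : ℝ) :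
    Continuous fun u => ∫ x in (s - u)..s, φ x := by
  have := (intervalIntegral.continuous_primitive h.intervalIntegrable s).comp
    (continuous_const.sub continuous_id : Continuous fun u : ℝ => s - u)
  refine this.neg.congr fun u => ?_
  simp [intervalIntegral.integral_symm s (s - u)]

theorem abs_integral_window_le (h : IsRenewalSolution ν φ B K κ S₀) (s u : ℝ) :
    |∫ x in (s - u)..s, φ x| ≤ B * |u| := by
  simpa using intervalIntegral.norm_integral_le_of_norm_le_const (a := s - u) (b := s)
    (f := φ) fun x _ => h.bound x

theorem integrable_window (h : IsRenewalSolution ν φ B K κ S₀) (hν : Integrable (fun u => u) ν)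
    (s : ℝ) : Integrable (fun u => ∫ x in (s - u)..s, φ x) ν := by
  refine Integrable.mono' (hν.abs.const_mul B)
    (h.continuous_primitive_sub s).aestronglyMeasurable (ae_of_all _ fun u => ?_)
  exact h.abs_integral_window_le s u

theorem integral_integral_swap [IsProbabilityMeasure ν] (h : IsRenewalSolution ν φ B K κ S₀)
    (s t : ℝ) :
    ∫ u, (∫ x in s..t, φ (x - u)) ∂ν = ∫ x in s..t, (∫ u, φ (x - u) ∂ν) := by
  have key : ∀ a b : ℝ, ∫ u, (∫ x in Ioc a b, φ (x - u)) ∂ν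
      = ∫ x in Ioc a b, (∫ u, φ (x - u) ∂ν) := by
    intro a b
    refine MeasureTheory.integral_integral_swap (f := fun u x => φ (x - u)) ?_
    refine Integrable.of_bound
      (h.measurable.comp (measurable_snd.sub measurable_fst)).aestronglyMeasurable B
      (ae_of_all _ fun q => h.bound _)
  have hint : ∀ a b : ℝ, Integrable (fun u => ∫ x in Ioc a b, φ (x - u)) ν := by
    intro a b
    have hm : StronglyMeasurable (Function.uncurry fun u x : ℝ => φ (x - u)) :=
      (h.measurable.comp (measurable_snd.sub measurable_fst)).stronglyMeasurable
    refine Integrable.of_bound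
      (hm.integral_prod_right (ν := volume.restrict (Ioc a b))).aestronglyMeasurable
      (B * (volume.restrict (Ioc a b)).real univ) (ae_of_all _ fun u => ?_)
    exact norm_integral_le_of_norm_le_const (ae_of_all _ fun x => h.bound _)
  simp only [intervalIntegral]
  rw [integral_sub (hint _ _) (hint _ _), key, key]

/-- Moving a window from `s` to `t` gains `φ` on `[s, t]` and loses it on `[s - u, t - u]`.
Averaging over `u` with Fubini leaves the renewal defect, which is why the charge is almost
conserved. -/
theorem renewalCharge_sub [IsProbabilityMeasure ν] (h : IsRenewalSolution ν φ B K κ S₀)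
    (hν : Integrable (fun u => u) ν) (s t : ℝ) :
    renewalCharge ν φ t - renewalCharge ν φ s = ∫ x in s..t, (φ x - ∫ u, φ (x - u) ∂ν) := by
  have h1 : ∀ u, (∫ x in (t - u)..t, φ x) - (∫ x in (s - u)..s, φ x)
      = (∫ x in s..t, φ x) - ∫ x in s..t, φ (x - u) := by
    intro u
    have a1 := intervalIntegral.integral_add_adjacent_intervals
      (h.intervalIntegrable (s - u) (t - u)) (h.intervalIntegrable (t - u) t)
    have a2 := intervalIntegral.integral_add_adjacent_intervals
      (h.intervalIntegrable (s - u) s) (h.intervalIntegrable s t)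
    rw [intervalIntegral.integral_comp_sub_right]
    linarith
  have h2 : Integrable (fun u => ∫ x in s..t, φ (x - u)) ν := by
    have := ((integrable_const (∫ x in s..t, φ x)).sub
      ((h.integrable_window hν t).sub (h.integrable_window hν s)))
    refine this.congr (ae_of_all _ fun u => ?_)
    have := h1 u
    simp only [Pi.sub_apply]
    linarith
  have h3 : IntervalIntegrable (fun x => ∫ u, φ (x - u) ∂ν) volume s t :=
    h.measurable_integral_comp_sub.intervalIntegrable_of_abs_le h.abs_integral_comp_sub_le s t
  rw [renewalCharge, renewalCharge,
    ← integral_sub (h.integrable_window hν t) (h.integrable_window hν s)]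
  simp_rw [h1]
  rw [integral_sub (integrable_const _) h2, h.integral_integral_swap,
    intervalIntegral.integral_sub (h.intervalIntegrable s t) h3]
  simp

theorem exists_tendsto_renewalCharge [IsProbabilityMeasure ν]
    (h : IsRenewalSolution ν φ B K κ S₀) (hν : Integrable (fun u => u) ν) :
    ∃ Q, Tendsto (renewalCharge ν φ) atTop (𝓝 Q) := by
  have hint : IntegrableOn (fun x => φ x - ∫ u, φ (x - u) ∂ν) (Ioi S₀) := by
    refine Integrable.mono' ((exp_neg_integrableOn_Ioi S₀ h.rate_pos).const_mul K)
      (h.measurable.sub h.measurable_integral_comp_sub).aestronglyMeasurable ?_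
    refine (ae_restrict_iff' measurableSet_Ioi).2 (ae_of_all _ fun x hx => ?_)
    exact h.small x (le_of_lt hx)
  have := (intervalIntegral_tendsto_integral_Ioi S₀ hint tendsto_id).add_const
    (renewalCharge ν φ S₀)
  refine ⟨_, this.congr fun t => ?_⟩
  simp [← h.renewalCharge_sub hν]

/-- If `M` is an asymptotic upper bound of `φ`, then `|M - φ|` is asymptotically a
supersolution of the renewal equation. -/
theorem exists_integral_abs_sub_le [IsProbabilityMeasure ν] (h : IsRenewalSolution ν φ B K κ S₀)
    {M : ℝ} (hM : ∀ ε > 0, ∀ᶠ s in atTop, φ s ≤ M + ε) :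
    ∃ r : ℝ → ℝ, Tendsto r atTop (𝓝 0) ∧
      ∀ s, S₀ ≤ s → ∫ u, |M - φ (s - u)| ∂ν ≤ |M - φ s| + r s := by
  have hmeas : ∀ s, Measurable fun u => φ (s - u) := fun s =>
    h.measurable.comp (measurable_const.sub measurable_id)
  have hbd : ∀ s, |max (φ s - M) 0| ≤ B + |M| := by
    intro s
    have h1 := abs_le.1 (h.bound s)
    have h2 := neg_abs_le M
    have h3 := abs_nonneg M
    rw [abs_of_nonneg (le_max_right _ _)]
    exact max_le (by linarith) (by linarith)
  have hmint : ∀ s, Integrable (fun u => max (φ (s - u) - M) 0) ν := fun s =>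
    Integrable.of_bound (((hmeas s).sub_const M).max measurable_const).aestronglyMeasurable
      (B + |M|) (ae_of_all _ fun u => hbd _)
  have hpos : Tendsto (fun s => max (φ s - M) 0) atTop (𝓝 0) := by
    rw [Metric.tendsto_nhds]
    intro ε hε
    filter_upwards [hM (ε / 2) (by linarith)] with s hs
    rw [Real.dist_eq, sub_zero, abs_of_nonneg (le_max_right _ _)]
    exact max_lt (by linarith) hε
  have htail : Tendsto (fun s => ∫ u, max (φ (s - u) - M) 0 ∂ν) atTop (𝓝 0) := by
    have := tendsto_integral_filter_of_dominated_convergence (μ := ν) (l := atTop)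
      (F := fun s u => max (φ (s - u) - M) 0) (f := fun _ => 0) (fun _ => B + |M|)
      (Eventually.of_forall fun s => (hmint s).aestronglyMeasurable)
      (Eventually.of_forall fun s => ae_of_all _ fun u => hbd _) (integrable_const _)
      (ae_of_all _ fun u => hpos.comp (tendsto_atTop_add_const_right atTop (-u) tendsto_id))
    simpa using this
  have hexp : Tendsto (fun s => K * Real.exp (-κ * s)) atTop (𝓝 0) := by
    have : Tendsto (fun s => -κ * s) atTop atBot :=
      tendsto_id.const_mul_atTop_of_neg (neg_lt_zero.2 h.rate_pos)
    simpa using (Real.tendsto_exp_atBot.comp this).const_mul K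
  refine ⟨fun s => K * Real.exp (-κ * s) + 2 * ∫ u, max (φ (s - u) - M) 0 ∂ν,
    by simpa using hexp.add (htail.const_mul 2), fun s hs => ?_⟩
  -- The linear part obeys the renewal equation up to the exponential error; only the positive part
  -- of `φ - M` spoils this, and its `ν`-average tends to zero by `htail`.
  have habs : ∀ x : ℝ, |M - x| = (M - x) + 2 * max (x - M) 0 := by
    intro x
    rcases le_total x M with hx | hx
    · rw [abs_of_nonneg (by linarith), max_eq_right (by linarith)]; ring
    · rw [abs_of_nonpos (by linarith), max_eq_left (by linarith)]; ring
  have hsplit : ∫ u, |M - φ (s - u)| ∂ν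
      = (M - ∫ u, φ (s - u) ∂ν) + 2 * ∫ u, max (φ (s - u) - M) 0 ∂ν := by
    simp_rw [habs]
    have hsub : Integrable (fun u => M - φ (s - u)) ν :=
      (integrable_const M).sub (h.integrable_comp_sub s)
    rw [integral_add hsub ((hmint s).const_mul 2),
      integral_sub (integrable_const M) (h.integrable_comp_sub s), integral_const_mul]
    simp
  have h1 := le_abs_self (M - φ s)
  have h2 := (le_abs_self _).trans (h.small s hs)
  rw [hsplit]
  linarith

end IsRenewalSolution

/-! ### Spreading smallness of a supersolution over long windows. -/

/-- Each `w` in the left-hand window is covered by `[s - β, s - α]` for a set of `s ∈ [x, y]` of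
length at least `e`. The proof replaces Fubini by monotonicity of a primitive of `Ψ`. -/
theorem mul_integral_le_integral_integral_window {Ψ : ℝ → ℝ}
    (hint : ∀ a b, IntervalIntegrable Ψ volume a b) (hnn : ∀ x, 0 ≤ Ψ x) {x y α β e : ℝ}
    (he : 0 ≤ e) (hxy : x + e ≤ y) (hαβ : α + e ≤ β) :
    e * ∫ w in (x - β + e)..(y - α - e), Ψ w ≤ ∫ s in x..y, (∫ w in (s - β)..(s - α), Ψ w) := by
  obtain ⟨F, hF⟩ : ∃ F : ℝ → ℝ, F = fun w => ∫ v in (0 : ℝ)..w, Ψ v := ⟨_, rfl⟩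
  have hFc : Continuous F := hF ▸ intervalIntegral.continuous_primitive hint 0
  have hsub : ∀ a b, ∫ w in a..b, Ψ w = F b - F a := fun a b => by
    rw [hF]; exact (intervalIntegral.integral_interval_sub_left (hint 0 b) (hint 0 a)).symm
  have hmono : Monotone F := fun a b hab => by
    have := intervalIntegral.integral_nonneg (μ := volume) hab fun u _ => hnn u
    rw [hsub] at this
    linarith
  have hi : ∀ d a b, IntervalIntegrable (fun s => F (s - d)) volume a b := fun d a b =>
    (hFc.comp (continuous_id.sub continuous_const)).intervalIntegrable a b
  have h1 : ∫ s in x..y, F (s - α) = (∫ s in x..(y - e), F (s - α)) + ∫ s in (y - e)..y, F (s - α) :=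
    (intervalIntegral.integral_add_adjacent_intervals (hi _ _ _) (hi _ _ _)).symm
  have h2 : ∫ s in x..y, F (s - β) = (∫ s in x..(x + e), F (s - β)) + ∫ s in (x + e)..y, F (s - β) :=
    (intervalIntegral.integral_add_adjacent_intervals (hi _ _ _) (hi _ _ _)).symm
  have h3 : e * F (y - α - e) ≤ ∫ s in (y - e)..y, F (s - α) := by
    have := intervalIntegral.integral_mono_on (μ := volume) (a := y - e) (b := y)
      (f := fun _ => F (y - α - e)) (g := fun s => F (s - α)) (by linarith)
      intervalIntegrable_const (hi _ _ _) fun s hs => hmono (by linarith [hs.1])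
    simpa using this
  have h4 : ∫ s in x..(x + e), F (s - β) ≤ e * F (x - β + e) := by
    have := intervalIntegral.integral_mono_on (μ := volume) (a := x) (b := x + e)
      (f := fun s => F (s - β)) (g := fun _ => F (x - β + e)) (by linarith)
      (hi _ _ _) intervalIntegrable_const fun s hs => hmono (by linarith [hs.2])
    simpa using this
  have h5 : ∫ s in (x + e)..y, F (s - β) ≤ ∫ s in x..(y - e), F (s - α) := by
    have hshift : ∫ s in (x + e)..y, F (s - β) = ∫ s in x..(y - e), F (s - (β - e)) := by
      have := intervalIntegral.integral_comp_sub_right (a := x + e) (b := y)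
        (fun s => F (s - (β - e))) e
      rw [add_sub_cancel_right] at this
      rw [← this]
      congr 1
      ext s
      ring_nf
    rw [hshift]
    exact intervalIntegral.integral_mono_on (by linarith) (hi _ _ _) (hi _ _ _)
      fun s _ => hmono (by linarith)
  simp_rw [hsub]
  rw [intervalIntegral.integral_sub (hi _ _ _) (hi _ _ _)]
  linarith

/-- A small value of `Ψ` at `s` makes its integral over `[s - β, s - α]` small. Integrating `hstep`
over a good window then yields a slightly longer good window, and induction reaches any length. -/
theorem exists_window_integral_le {Ψ r : ℝ → ℝ} {c α β S₀ : ℝ}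
    (hint : ∀ a b, IntervalIntegrable Ψ volume a b) (hnn : ∀ x, 0 ≤ Ψ x) (hc : 0 < c)
    (hαβ : α < β) (hr : Tendsto r atTop (𝓝 0))
    (hstep : ∀ s, S₀ ≤ s → c * ∫ w in (s - β)..(s - α), Ψ w ≤ Ψ s + r s)
    (hfreq : ∀ ε > 0, ∃ᶠ s in atTop, Ψ s ≤ ε) (L ε S : ℝ) (hε : 0 < ε) :
    ∃ s, S ≤ s ∧ ∫ w in (s - L)..s, Ψ w ≤ ε := by
  have hr' : ∀ ρ > 0, ∃ S, ∀ s, S ≤ s → r s ≤ ρ := fun ρ hρ =>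
    eventually_atTop.1 ((hr.eventually (gt_mem_nhds hρ)).mono fun s hs => le_of_lt hs)
  have hmono : ∀ {a b a' b' : ℝ}, a' ≤ a → a ≤ b → b ≤ b' →
      ∫ w in a..b, Ψ w ≤ ∫ w in a'..b', Ψ w := fun h1 h2 h3 =>
    intervalIntegral.integral_mono_interval h1 h2 h3 (ae_of_all _ hnn) (hint _ _)
  -- Each induction step adds `β - α` to the window length and loses `e` at both ends, a net gain of
  -- `e`.
  obtain ⟨e, he⟩ : ∃ e, β - α = 3 * e := ⟨(β - α) / 3, by ring⟩
  have he0 : 0 < e := by linarith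
  have key : ∀ n : ℕ, ∀ ε > 0, ∀ S, ∃ s, S ≤ s ∧ ∫ w in (s - (n + 3) * e)..s, Ψ w ≤ ε := by
    intro n
    induction n with
    | zero =>
      intro ε hε S
      obtain ⟨S₁, hS₁⟩ := hr' (c * ε / 2) (by positivity)
      obtain ⟨s, hs, hΨs⟩ := frequently_atTop.1 (hfreq (c * ε / 2) (by positivity))
        (max S₀ (max S₁ (S + α)))
      have hs0 := (le_max_left _ _).trans hs
      have hs1 := ((le_max_left _ _).trans (le_max_right _ _)).trans hs
      have hs2 := ((le_max_right _ _).trans (le_max_right _ _)).trans hs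
      refine ⟨s - α, by linarith, ?_⟩
      have h1 := hstep s hs0
      have h2 := hS₁ s hs1
      have h3 : s - α - ((0 : ℕ) + 3) * e = s - β := by push_cast; linarith
      rw [h3]
      exact le_of_mul_le_mul_left (by linarith) hc
    | succ n ih =>
      intro ε hε S
      have hL : 0 < ((n : ℝ) + 3) * e := by positivity
      obtain ⟨ℓ, hℓ⟩ : ∃ ℓ, ℓ = ((n : ℝ) + 3) * e := ⟨_, rfl⟩
      have hle : e ≤ ℓ := by rw [hℓ]; nlinarith [(Nat.cast_nonneg n : (0 : ℝ) ≤ n)]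
      rw [← hℓ] at hL
      obtain ⟨S₁, hS₁⟩ := hr' (c * e * ε / 2 / ℓ) (by positivity)
      obtain ⟨s, hs, hΨs⟩ := ih (c * e * ε / 2) (by positivity)
        (max (S₀ + ℓ) (max (S₁ + ℓ) (S + α + e)))
      have hs0 := (le_max_left _ _).trans hs
      have hs1 := ((le_max_left _ _).trans (le_max_right _ _)).trans hs
      have hs2 := ((le_max_right _ _).trans (le_max_right _ _)).trans hs
      rw [← hℓ] at hΨs
      refine ⟨s - α - e, by linarith, ?_⟩
      have h1 := mul_integral_le_integral_integral_window hint hnn (x := s - ℓ) (y := s)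
        (α := α) (β := β) he0.le (by linarith) (by linarith)
      have hcont : Continuous fun t => ∫ w in (t - β)..(t - α), Ψ w := by
        have hP := intervalIntegral.continuous_primitive hint 0
        refine ((hP.comp (continuous_sub_right α)).sub
          (hP.comp (continuous_sub_right β))).congr fun t => ?_
        exact intervalIntegral.integral_interval_sub_left (hint _ _) (hint _ _)
      have h2 : ∫ t in (s - ℓ)..s, c * ∫ w in (t - β)..(t - α), Ψ w
          ≤ ∫ t in (s - ℓ)..s, (Ψ t + c * e * ε / 2 / ℓ) := by
        refine intervalIntegral.integral_mono_on (by linarith)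
          ((continuous_const.mul hcont).intervalIntegrable _ _)
          ((hint _ _).add intervalIntegrable_const) fun t ht => ?_
        have h3 := hstep t (by linarith [ht.1])
        have h4 := hS₁ t (by linarith [ht.1])
        linarith
      rw [intervalIntegral.integral_const_mul,
        intervalIntegral.integral_add (hint _ _) intervalIntegrable_const,
        intervalIntegral.integral_const, sub_sub_cancel, smul_eq_mul,
        mul_div_cancel₀ _ hL.ne'] at h2
      have h5 : s - α - e - ((n + 1 : ℕ) + 3) * e = s - ℓ - β + e := by
        rw [hℓ]; push_cast; linarith
      rw [h5]
      have h6 := mul_le_mul_of_nonneg_left h1 hc.le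
      refine le_of_mul_le_mul_left (a := c * e) ?_ (by positivity)
      linarith
  obtain ⟨n, hn⟩ := exists_nat_ge (L / e)
  have hn' : L ≤ n * e := (div_le_iff₀ he0).1 hn
  obtain ⟨s, hs, hw⟩ := key n ε hε S
  refine ⟨s, hs, ?_⟩
  rcases le_total L 0 with hL | hL
  · rw [intervalIntegral.integral_symm]
    have := intervalIntegral.integral_nonneg (μ := volume) (a := s) (b := s - L) (by linarith)
      fun u _ => hnn u
    linarith
  · exact (hmono (by linarith) (by linarith) le_rfl).trans hw

/-! ### The renewal theorem. -/

namespace IsRenewalSolution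

variable {ν : Measure ℝ} {φ : ℝ → ℝ} {B K κ S₀ : ℝ}

/-- The conserved quantity of a solution equals the mean of `ν` times the upper limit of the
solution. -/
theorem renewalCharge_limit_eq [IsProbabilityMeasure ν] (h : IsRenewalSolution ν φ B K κ S₀)
    (hν : Integrable (fun u => u) ν) (hpos : ∀ᵐ u ∂ν, 0 < u) {c α β : ℝ} (hc : 0 < c)
    (hαβ : α < β) (hlb : ENNReal.ofReal c • volume.restrict (Icc α β) ≤ ν) {M Q : ℝ}
    (hM : ∀ ε > 0, ∀ᶠ s in atTop, φ s ≤ M + ε) (hM' : ∀ ε > 0, ∃ᶠ s in atTop, M - ε ≤ φ s)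
    (hQ : Tendsto (renewalCharge ν φ) atTop (𝓝 Q)) : Q = M * ∫ u, u ∂ν := by
  obtain ⟨r, hr, hstar⟩ := h.exists_integral_abs_sub_le hM
  have hΨm : Measurable fun s => |M - φ s| := (measurable_const.sub h.measurable).abs
  have hΨB : ∀ s, |M - φ s| ≤ |M| + B := fun s =>
    (abs_sub _ _).trans (add_le_add_right (h.bound s) _)
  have hΨint : ∀ a b, IntervalIntegrable (fun s => |M - φ s|) volume a b :=
    hΨm.intervalIntegrable_of_abs_le fun s => by rw [abs_abs]; exact hΨB s
  have hstep : ∀ s, S₀ ≤ s → c * ∫ w in (s - β)..(s - α), |M - φ w| ≤ |M - φ s| + r s := by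
    intro s hs
    refine le_trans ?_ (hstar s hs)
    have hi : Integrable (fun u => |M - φ (s - u)|) ν :=
      Integrable.of_bound (hΨm.comp (measurable_const.sub measurable_id)).aestronglyMeasurable
        (|M| + B) (ae_of_all _ fun u => by rw [Real.norm_eq_abs, abs_abs]; exact hΨB _)
    have h1 := integral_mono_measure hlb (ae_of_all _ fun u => abs_nonneg (M - φ (s - u))) hi
    rw [integral_smul_measure, ENNReal.toReal_ofReal hc.le, integral_Icc_eq_integral_Ioc,
      ← intervalIntegral.integral_of_le hαβ.le,
      intervalIntegral.integral_comp_sub_left (fun w => |M - φ w|) s] at h1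
    exact h1
  have hfreq : ∀ ε > 0, ∃ᶠ s in atTop, |M - φ s| ≤ ε := fun ε hε =>
    ((hM' ε hε).and_eventually (hM ε hε)).mono fun s hs =>
      abs_le.2 ⟨by linarith [hs.2], by linarith [hs.1]⟩
  -- Window length, position and accuracy all depend on `n`: the window at `s n` eventually contains
  -- `[s n - u, s n]` for each fixed `u > 0`, while `s n → ∞`.
  have hw := fun n : ℕ => exists_window_integral_le hΨint (fun x => abs_nonneg _) hc hαβ hr hstep
    hfreq n (1 / ((n : ℝ) + 1)) n (by positivity)
  choose s hs hsw using hw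
  have hsTop : Tendsto s atTop atTop := tendsto_atTop_mono hs tendsto_natCast_atTop_atTop
  have hlim : Tendsto (fun n => renewalCharge ν φ (s n)) atTop (𝓝 (∫ u, M * u ∂ν)) := by
    refine tendsto_integral_filter_of_dominated_convergence (fun u => B * |u|)
      (Eventually.of_forall fun n => (h.integrable_window hν (s n)).aestronglyMeasurable)
      (Eventually.of_forall fun n => ae_of_all _ fun u => h.abs_integral_window_le (s n) u)
      (hν.abs.const_mul B) ?_
    filter_upwards [hpos] with u hu
    rw [tendsto_iff_dist_tendsto_zero]
    refine squeeze_zero' (Eventually.of_forall fun n => dist_nonneg) ?_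
      tendsto_one_div_add_atTop_nhds_zero_nat
    filter_upwards [eventually_ge_atTop ⌈u⌉₊] with n hn
    have hun : u ≤ n := Nat.ceil_le.1 hn
    refine le_trans ?_ (hsw n)
    have h1 : M * u - ∫ x in (s n - u)..s n, φ x = ∫ x in (s n - u)..s n, (M - φ x) := by
      rw [intervalIntegral.integral_sub intervalIntegrable_const (h.intervalIntegrable _ _),
        intervalIntegral.integral_const, sub_sub_cancel, smul_eq_mul, mul_comm]
    rw [dist_comm, Real.dist_eq, h1]
    exact (intervalIntegral.abs_integral_le_integral_abs (by linarith)).trans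
      (intervalIntegral.integral_mono_interval (by linarith) (by linarith) le_rfl
        (ae_of_all _ fun x => abs_nonneg _) (hΨint _ _))
  rw [integral_const_mul] at hlim
  exact tendsto_nhds_unique (hQ.comp hsTop) hlim

/-- Renewal theorem: a bounded function satisfying the renewal equation for a spread-out
distribution with finite mean, up to an exponentially small error, converges at infinity. -/
theorem exists_tendsto [IsProbabilityMeasure ν] (h : IsRenewalSolution ν φ B K κ S₀)
    (hν : Integrable (fun u => u) ν) (hpos : ∀ᵐ u ∂ν, 0 < u) {c α β : ℝ} (hc : 0 < c)
    (hαβ : α < β) (hlb : ENNReal.ofReal c • volume.restrict (Icc α β) ≤ ν) :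
    ∃ L, Tendsto φ atTop (𝓝 L) := by
  obtain ⟨Q, hQ⟩ := h.exists_tendsto_renewalCharge hν
  have hbdd : IsBoundedUnder (· ≤ ·) atTop φ :=
    isBoundedUnder_of ⟨B, fun s => (abs_le.1 (h.bound s)).2⟩
  have hbdd' : IsBoundedUnder (· ≥ ·) atTop φ :=
    isBoundedUnder_of ⟨-B, fun s => (abs_le.1 (h.bound s)).1⟩
  have hsup : Q = limsup φ atTop * ∫ u, u ∂ν := by
    refine h.renewalCharge_limit_eq hν hpos hc hαβ hlb (fun ε hε => ?_) (fun ε hε => ?_) hQ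
    · exact (eventually_lt_of_limsup_lt (by linarith) hbdd).mono fun s hs => le_of_lt hs
    · exact (frequently_lt_of_lt_limsup hbdd'.isCoboundedUnder_flip (by linarith)).mono
        fun s hs => le_of_lt hs
  -- For `-φ` the upper limit is `-liminf φ` and the charge changes sign.
  have hinf : -Q = -liminf φ atTop * ∫ u, u ∂ν := by
    refine h.neg.renewalCharge_limit_eq hν hpos hc hαβ hlb (fun ε hε => ?_) (fun ε hε => ?_) ?_
    · exact (eventually_lt_of_lt_liminf (b := liminf φ atTop - ε) (by linarith) hbdd').mono
        fun s hs => by linarith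
    · exact (frequently_lt_of_liminf_lt (b := liminf φ atTop + ε) hbdd.isCoboundedUnder_flip
        (by linarith)).mono fun s hs => by linarith
    · refine hQ.neg.congr fun s => ?_
      simp [renewalCharge, integral_neg]
  have hmean : 0 < ∫ u, u ∂ν := by
    rw [integral_pos_iff_support_of_nonneg_ae (hpos.mono fun u hu => le_of_lt hu) hν]
    have : ν (Function.support fun u : ℝ => u) = 1 := by
      refine (prob_compl_eq_zero_iff (s := Function.support fun u : ℝ => u)
        (measurableSet_support measurable_id)).1 ?_
      refine measure_mono_null ?_ (ae_iff.1 hpos)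
      intro u hu
      have : u = 0 := by simpa using hu
      simp [this]
    rw [this]
    exact one_pos
  have heq : limsup φ atTop = liminf φ atTop :=
    mul_right_cancel₀ hmean.ne' (by linarith)
  exact ⟨_, tendsto_of_le_liminf_of_limsup_le le_rfl heq.le hbdd hbdd'⟩

end IsRenewalSolution

/-! ### The law of `-log T`. -/

theorem Real.measurable_neg_log : Measurable fun t : ℝ => -Real.log t :=
  Real.measurable_log.neg

/-- The law of `-log T`, where `T` has density `p` on `(0, 1)`. -/
noncomputable def negLogLaw (p : ℝ → ℝ) : Measure ℝ :=
  ((volume.restrict (Ioo 0 1)).withDensity fun t => ENNReal.ofReal (p t)).map fun t => -Real.log t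

namespace IsContinuousDensity

variable {p : ℝ → ℝ}

theorem aemeasurable_ofReal (hp : IsContinuousDensity p) :
    AEMeasurable (fun t => ENNReal.ofReal (p t)) (volume.restrict (Ioo 0 1)) :=
  hp.integrableOn.aemeasurable.ennreal_ofReal

theorem isProbabilityMeasure_withDensity (hp : IsContinuousDensity p) :
    IsProbabilityMeasure
      ((volume.restrict (Ioo 0 1)).withDensity fun t => ENNReal.ofReal (p t)) := by
  refine ⟨?_⟩
  rw [withDensity_apply _ MeasurableSet.univ, Measure.restrict_univ,
    ← ofReal_integral_eq_lintegral_ofReal hp.integrableOn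
      ((ae_restrict_iff' measurableSet_Ioo).2 (ae_of_all _ hp.nonneg)), hp.integral_eq_one,
    ENNReal.ofReal_one]

theorem isProbabilityMeasure_negLogLaw (hp : IsContinuousDensity p) :
    IsProbabilityMeasure (negLogLaw p) := by
  have := hp.isProbabilityMeasure_withDensity
  exact Measure.isProbabilityMeasure_map Real.measurable_neg_log.aemeasurable

theorem integral_negLogLaw (hp : IsContinuousDensity p) {f : ℝ → ℝ} (hf : Measurable f) :
    ∫ u, f u ∂negLogLaw p = ∫ t in Ioo (0 : ℝ) 1, p t * f (-Real.log t) := by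
  rw [negLogLaw, integral_map Real.measurable_neg_log.aemeasurable hf.aestronglyMeasurable,
    integral_withDensity_eq_integral_toReal_smul₀ hp.aemeasurable_ofReal
      (ae_of_all _ fun _ => ENNReal.ofReal_lt_top)]
  refine setIntegral_congr_fun measurableSet_Ioo fun t ht => ?_
  simp [ENNReal.toReal_ofReal (hp.nonneg t ht)]

theorem integrable_negLogLaw (hp : IsContinuousDensity p)
    (hlog : IntegrableOn (fun t => p t * Real.log (1 / t)) (Ioo 0 1)) :
    Integrable (fun u => u) (negLogLaw p) := by
  rw [negLogLaw, integrable_map_measure (g := fun u => u) measurable_id.aestronglyMeasurable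
    Real.measurable_neg_log.aemeasurable,
    integrable_withDensity_iff_integrable_smul₀' hp.aemeasurable_ofReal
      (ae_of_all _ fun _ => ENNReal.ofReal_lt_top)]
  refine IntegrableOn.congr_fun hlog (fun t ht => ?_) measurableSet_Ioo
  simp [ENNReal.toReal_ofReal (hp.nonneg t ht)]

theorem ae_pos_negLogLaw (p : ℝ → ℝ) : ∀ᵐ u ∂negLogLaw p, 0 < u := by
  refine (ae_map_iff Real.measurable_neg_log.aemeasurable measurableSet_Ioi).2 ?_
  refine (withDensity_absolutelyContinuous _ _).ae_le ?_
  refine (ae_restrict_iff' measurableSet_Ioo).2 (ae_of_all _ fun t ht => ?_)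
  exact neg_pos.2 (Real.log_neg ht.1 ht.2)

theorem exists_Icc_lower_bound (hp : IsContinuousDensity p) :
    ∃ c > 0, ∃ a b, 0 < a ∧ a < b ∧ b < 1 ∧ ∀ t ∈ Icc a b, c ≤ p t := by
  obtain ⟨t₀, ht₀, hpos⟩ : ∃ t ∈ Ioo (0 : ℝ) 1, 0 < p t := by
    by_contra! hcon
    have := setIntegral_nonpos measurableSet_Ioo hcon (μ := volume)
    linarith [hp.integral_eq_one]
  have hev : ∀ᶠ t in 𝓝 t₀, p t₀ / 2 < p t ∧ t ∈ Ioo (0 : ℝ) 1 :=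
    ((hp.continuousOn.continuousAt (isOpen_Ioo.mem_nhds ht₀)).eventually
      (lt_mem_nhds (half_lt_self hpos))).and (isOpen_Ioo.mem_nhds ht₀)
  obtain ⟨δ, hδ, hball⟩ := Metric.eventually_nhds_iff_ball.1 hev
  have hmem : ∀ t ∈ Icc t₀ (t₀ + δ / 2), t ∈ Metric.ball t₀ δ := fun t ht => by
    rw [Metric.mem_ball, Real.dist_eq, abs_of_nonneg (by linarith [ht.1])]
    linarith [ht.2]
  exact ⟨p t₀ / 2, by linarith, t₀, t₀ + δ / 2, ht₀.1, by linarith,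
    (hball _ (hmem _ ⟨by linarith, le_rfl⟩)).2.2, fun t ht => (hball t (hmem t ht)).1.le⟩

/-- Where `p ≥ c` on `[a, b]`, the image density `p (exp (-u)) * exp (-u)` is at least `c * a` for
`u ∈ [-log b, -log a]`. -/
theorem exists_smul_restrict_le_negLogLaw (hp : IsContinuousDensity p) :
    ∃ c α β, 0 < c ∧ α < β ∧
      ENNReal.ofReal c • volume.restrict (Icc α β) ≤ negLogLaw p := by
  obtain ⟨c, hc, a, b, ha, hab, hb, hcp⟩ := hp.exists_Icc_lower_bound
  refine ⟨c * a, -Real.log b, -Real.log a, by positivity,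
    neg_lt_neg (Real.log_lt_log ha hab), Measure.le_iff.2 fun E hE => ?_⟩
  obtain ⟨D, hD⟩ : ∃ D, D = E ∩ Icc (-Real.log b) (-Real.log a) := ⟨_, rfl⟩
  have hDm : MeasurableSet D := hD ▸ hE.inter measurableSet_Icc
  have himage : (fun u : ℝ => Real.exp (-u)) '' D ⊆ Icc a b ∩ (fun t => -Real.log t) ⁻¹' E := by
    rintro _ ⟨u, hu, rfl⟩
    rw [hD] at hu
    refine ⟨⟨?_, ?_⟩, ?_⟩
    · rw [← Real.log_le_iff_le_exp ha]; linarith [hu.2.2]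
    · rw [← Real.le_log_iff_exp_le (ha.trans hab)]; linarith [hu.2.1]
    · simpa using hu.1
  have hder : ∀ u ∈ D, HasDerivWithinAt (fun u : ℝ => Real.exp (-u)) (-Real.exp (-u)) D u :=
    fun u _ => by simpa using ((hasDerivAt_neg u).exp).hasDerivWithinAt
  have hinj : InjOn (fun u : ℝ => Real.exp (-u)) D := fun u _ v _ huv => by
    simpa using huv
  have hvol : ENNReal.ofReal a * volume D ≤ volume ((fun u : ℝ => Real.exp (-u)) '' D) := by
    have h1 := lintegral_image_eq_lintegral_abs_deriv_mul hDm hder hinj (fun _ => 1)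
    rw [setLIntegral_one] at h1
    rw [h1, ← setLIntegral_const]
    refine setLIntegral_mono' hDm fun u hu => ?_
    rw [hD] at hu
    rw [mul_one, abs_neg, abs_of_pos (Real.exp_pos _)]
    refine ENNReal.ofReal_le_ofReal ?_
    rw [← Real.log_le_iff_le_exp ha]
    linarith [hu.2.2]
  have hG : MeasurableSet (Icc a b ∩ (fun t => -Real.log t) ⁻¹' E) :=
    measurableSet_Icc.inter (Real.measurable_neg_log hE)
  have hsub : Icc a b ∩ (fun t => -Real.log t) ⁻¹' E
      ⊆ ((fun t => -Real.log t) ⁻¹' E) ∩ Ioo 0 1 := fun t ht =>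
    ⟨ht.2, ha.trans_le ht.1.1, ht.1.2.trans_lt hb⟩
  calc (ENNReal.ofReal (c * a) • volume.restrict (Icc (-Real.log b) (-Real.log a))) E
      = ENNReal.ofReal c * (ENNReal.ofReal a * volume D) := by
        rw [Measure.smul_apply, Measure.restrict_apply hE, hD, smul_eq_mul,
          ENNReal.ofReal_mul hc.le, mul_assoc]
    _ ≤ ENNReal.ofReal c * volume (Icc a b ∩ (fun t => -Real.log t) ⁻¹' E) := by
        gcongr
        exact hvol.trans (measure_mono himage)
    _ = ∫⁻ _ in Icc a b ∩ (fun t => -Real.log t) ⁻¹' E, ENNReal.ofReal c := by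
        rw [setLIntegral_const]
    _ ≤ ∫⁻ t in Icc a b ∩ (fun t => -Real.log t) ⁻¹' E, ENNReal.ofReal (p t) :=
        setLIntegral_mono' hG fun t ht => ENNReal.ofReal_le_ofReal (hcp t ht.1)
    _ ≤ ∫⁻ t in ((fun t => -Real.log t) ⁻¹' E) ∩ Ioo 0 1, ENNReal.ofReal (p t) :=
        lintegral_mono_set hsub
    _ = negLogLaw p E := by
        rw [negLogLaw, Measure.map_apply Real.measurable_neg_log hE,
          withDensity_apply _ (Real.measurable_neg_log hE),
          Measure.restrict_restrict (Real.measurable_neg_log hE)]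

end IsContinuousDensity

/-! ### From the averaging recursion to the renewal equation. -/

theorem measurable_stepDensity (q : ℕ → PMF ℕ) (x : ℝ) : Measurable (stepDensity q x) := by
  have h1 : Measurable fun m : ℕ => x * (q ⌊x⌋₊ m).toReal := measurable_from_nat
  exact h1.comp (Nat.measurable_ceil.comp (measurable_id.mul_const x))

theorem stepDensity_nonneg (q : ℕ → PMF ℕ) {x : ℝ} (hx : 0 ≤ x) (t : ℝ) : 0 ≤ stepDensity q x t :=
  mul_nonneg hx ENNReal.toReal_nonneg

theorem stepDensity_le (q : ℕ → PMF ℕ) {x : ℝ} (hx : 0 ≤ x) (t : ℝ) : stepDensity q x t ≤ x :=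
  mul_le_of_le_one_right hx (ENNReal.toReal_le_of_le_ofReal zero_le_one
    (by simpa using PMF.coe_le_one _ _))

theorem sum_Icc_toReal_eq_one {μ : PMF ℕ} {n : ℕ} (hμ : μ.support ⊆ Icc 1 n) :
    ∑ j ∈ Finset.Icc 1 n, (μ j).toReal = 1 := by
  rw [← ENNReal.toReal_sum fun j _ => μ.apply_ne_top j, ← tsum_eq_sum (L := .unconditional ℕ)
    (f := fun j => μ j), μ.tsum_coe, ENNReal.toReal_one]
  intro j hj
  by_contra hne
  exact hj (by simpa using hμ ((μ.mem_support_iff j).2 hne))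

/-- The averaging recursion as an integral against the step density. -/
theorem integral_stepDensity_mul (q : ℕ → PMF ℕ)
    (hsupp : ∀ n : ℕ, 1 ≤ n → (q n).support ⊆ Icc 1 n) (b : ℕ → ℝ) {x : ℝ} (hx : 1 ≤ x) :
    ∫ t in Ioo (0 : ℝ) 1, stepDensity q x t * b (⌊t * x⌋₊ + 1)
      = ∑ j ∈ Finset.Icc 1 ⌊x⌋₊, (q ⌊x⌋₊ j).toReal * b j := by
  obtain ⟨n, hn⟩ : ∃ n, n = ⌊x⌋₊ := ⟨_, rfl⟩
  have hx0 : 0 < x := by linarith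
  have hn1 : 1 ≤ n := hn ▸ (Nat.one_le_floor_iff x).2 hx
  have hnx : (n : ℝ) ≤ x := hn ▸ Nat.floor_le hx0.le
  have hxn : x < n + 1 := hn ▸ Nat.lt_floor_add_one x
  -- Off the integers `⌈y⌉₊ = ⌊y⌋₊ + 1`, so `g` is almost everywhere a step function with unit
  -- cells.
  obtain ⟨g, hg⟩ : ∃ g : ℝ → ℝ, g = fun y => (q n ⌈y⌉₊).toReal * b (⌊y⌋₊ + 1) := ⟨_, rfl⟩
  have hg1 : ∀ i : ℕ, ∀ y ∈ Ioo (i : ℝ) (i + 1), g y = (q n (i + 1)).toReal * b (i + 1) := by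
    intro i y hy
    have h1 : ⌈y⌉₊ = i + 1 := by
      rw [Nat.ceil_eq_iff (by omega)]
      refine ⟨by simpa using hy.1, by simpa using hy.2.le⟩
    have h2 : ⌊y⌋₊ = i := by
      rw [Nat.floor_eq_iff (i.cast_nonneg.trans hy.1.le)]
      exact ⟨hy.1.le, hy.2⟩
    rw [hg]; simp only [h1, h2]
  have hae : ∀ i : ℕ, ∀ d : ℝ, d ≤ i + 1 → ∀ᵐ y, y ∈ Ioc (i : ℝ) d →
      g y = (q n (i + 1)).toReal * b (i + 1) := by
    intro i d hd
    filter_upwards [compl_mem_ae_iff.2 (measure_singleton ((i : ℝ) + 1))] with y hy hyI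
    exact hg1 i y ⟨hyI.1, lt_of_le_of_ne (hyI.2.trans hd) hy⟩
  have hint : ∀ i : ℕ, ∀ d : ℝ, i ≤ d → d ≤ i + 1 → IntervalIntegrable g volume i d ∧
      ∫ y in (i : ℝ)..d, g y = (d - i) * ((q n (i + 1)).toReal * b (i + 1)) := by
    intro i d hid hd
    have h1 := hae i d hd
    rw [← uIoc_of_le hid] at h1
    refine ⟨(intervalIntegrable_const (c := (q n (i + 1)).toReal * b (i + 1))).congr_ae ?_, ?_⟩
    · exact ((ae_restrict_iff' measurableSet_uIoc).2 h1).mono fun y hy => hy.symm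
    · rw [intervalIntegral.integral_congr_ae h1, intervalIntegral.integral_const, smul_eq_mul]
  have hadj : ∀ i : ℕ, IntervalIntegrable g volume (i : ℕ) ((i + 1 : ℕ) : ℝ) := fun i => by
    push_cast
    exact (hint i (i + 1) (by linarith) le_rfl).1
  have hsum := intervalIntegral.sum_integral_adjacent_intervals (μ := volume) (f := g)
    (a := fun i : ℕ => (i : ℝ)) (n := n) fun i _ => hadj i
  have hn0 : IntervalIntegrable g volume (0 : ℝ) n := by
    simpa using IntervalIntegrable.trans_iterate (a := fun i : ℕ => (i : ℝ)) (n := n)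
      fun i _ => hadj i
  -- The incomplete cell `(n, x]` carries the index `n + 1`, outside the support.
  have hlast : q n (n + 1) = 0 := by
    by_contra hne
    have := hsupp n hn1 (((q n).mem_support_iff (n + 1)).2 hne)
    simp at this
  obtain ⟨hi, hlastint⟩ := hint n x hnx hxn.le
  rw [hlast] at hlastint
  have hstep : ∫ t in Ioo (0 : ℝ) 1, stepDensity q x t * b (⌊t * x⌋₊ + 1)
      = x * ∫ t in (0 : ℝ)..1, g (t * x) := by
    rw [intervalIntegral.integral_of_le zero_le_one, integral_Ioc_eq_integral_Ioo,
      ← integral_const_mul]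
    refine integral_congr_ae (ae_of_all _ fun t => ?_)
    simp only [stepDensity, hg, ← hn]
    ring
  rw [hstep, intervalIntegral.mul_integral_comp_mul_right, zero_mul, one_mul,
    ← intervalIntegral.integral_add_adjacent_intervals hn0 hi, hlastint, ← hn,
    show Finset.Icc 1 n = Finset.Ico 1 (n + 1) from rfl, Finset.sum_Ico_eq_sum_range]
  simp only [Nat.cast_zero] at hsum
  rw [← hsum]
  simp only [ENNReal.toReal_zero, zero_mul, mul_zero, add_zero]
  refine Finset.sum_congr (by simp) fun i _ => ?_
  have := (hint i (i + 1) (by linarith) le_rfl).2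
  push_cast
  rw [this, add_sub_cancel_left, one_mul, add_comm 1 i]

/-- Later terms are convex combinations of earlier ones, so any bound for the terms up to index `k`
persists. -/
theorem exists_bound_of_averaging {q : ℕ → PMF ℕ}
    (hsupp : ∀ n : ℕ, 1 ≤ n → (q n).support ⊆ Icc 1 n) {k : ℕ} (hk : 1 ≤ k) {b : ℕ → ℝ}
    (hb : ∀ n : ℕ, k ≤ n → b (n + 1) = ∑ j ∈ Finset.Icc 1 n, (q n j).toReal * b j) :
    ∃ B, ∀ n, |b n| ≤ B := by
  refine ⟨∑ j ∈ Finset.range (k + 1), |b j|, fun n => ?_⟩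
  induction n using Nat.strong_induction_on with
  | _ n ih =>
    rcases lt_or_ge n (k + 1) with hn | hn
    · exact Finset.single_le_sum (f := fun j => |b j|) (fun j _ => abs_nonneg _)
        (Finset.mem_range.2 hn)
    · obtain ⟨m, rfl⟩ : ∃ m, n = m + 1 := ⟨n - 1, by omega⟩
      rw [hb m (by omega)]
      refine (Finset.abs_sum_le_sum_abs _ _).trans ?_
      rw [← one_mul (∑ j ∈ Finset.range (k + 1), |b j|),
        ← sum_Icc_toReal_eq_one (hsupp m (by omega)), Finset.sum_mul]
      refine Finset.sum_le_sum fun j hj => ?_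
      rw [abs_mul, abs_of_nonneg ENNReal.toReal_nonneg]
      exact mul_le_mul_of_nonneg_left (ih j (by have := Finset.mem_Icc.1 hj; omega))
        ENNReal.toReal_nonneg

theorem exists_tendsto_of_averaging {p : ℝ → ℝ} (hp : IsContinuousDensity p)
    (hlog : IntegrableOn (fun t => p t * Real.log (1 / t)) (Ioo 0 1)) {q : ℕ → PMF ℕ}
    (hsupp : ∀ n : ℕ, 1 ≤ n → (q n).support ⊆ Icc 1 n) (hq : StronglyDiscretizes q p)
    {k : ℕ} (hk : 1 ≤ k) {b : ℕ → ℝ}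
    (hb : ∀ n : ℕ, k ≤ n → b (n + 1) = ∑ j ∈ Finset.Icc 1 n, (q n j).toReal * b j) :
    ∃ L, Tendsto b atTop (𝓝 L) := by
  obtain ⟨B, hB⟩ := exists_bound_of_averaging hsupp hk hb
  have hB0 : 0 ≤ B := (abs_nonneg _).trans (hB 0)
  obtain ⟨κ, C, hκ, hC, hqC⟩ := hq
  have := hp.isProbabilityMeasure_negLogLaw
  obtain ⟨c, α, β, hc, hαβ, hlb⟩ := hp.exists_smul_restrict_le_negLogLaw
  have hbm : Measurable fun y : ℝ => b (⌊y⌋₊ + 1) :=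
    (measurable_from_nat (f := fun m => b (m + 1))).comp Nat.measurable_floor
  have hφm : Measurable fun s : ℝ => b (⌊Real.exp s⌋₊ + 1) := hbm.comp Real.measurable_exp
  -- Past `log (max C k)`, `x = exp s` satisfies both `x ≥ C`, for the discretization bound, and
  -- `⌊x⌋₊ ≥ k`, for the recursion. The constant is the sup bound `B` times the `L¹` constant `C`.
  have hsol : IsRenewalSolution (negLogLaw p) (fun s => b (⌊Real.exp s⌋₊ + 1)) B (B * C) κ
      (Real.log (max C k)) := by
    refine ⟨hφm, fun s => hB _, hκ, fun s hs => ?_⟩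
    obtain ⟨x, hx⟩ : ∃ x, x = Real.exp s := ⟨_, rfl⟩
    have hk0 : (1 : ℝ) ≤ k := by exact_mod_cast hk
    have hmax : max C k ≤ x := by
      rw [hx, ← Real.log_le_iff_le_exp (lt_max_of_lt_left hC)]
      exact hs
    have hCx : C ≤ x := (le_max_left _ _).trans hmax
    have hkx : (k : ℝ) ≤ x := (le_max_right _ _).trans hmax
    have hx0 : 0 < x := by linarith
    have hint : ∫ u, b (⌊Real.exp (s - u)⌋₊ + 1) ∂negLogLaw p
        = ∫ t in Ioo (0 : ℝ) 1, p t * b (⌊t * x⌋₊ + 1) := by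
      rw [hp.integral_negLogLaw (f := fun u => b (⌊Real.exp (s - u)⌋₊ + 1))
        (hφm.comp (measurable_const.sub measurable_id))]
      refine setIntegral_congr_fun measurableSet_Ioo fun t ht => ?_
      simp only [sub_neg_eq_add, Real.exp_add, Real.exp_log ht.1, ← hx]
      rw [mul_comm x t]
    have hrec : b (⌊x⌋₊ + 1) = ∫ t in Ioo (0 : ℝ) 1, stepDensity q x t * b (⌊t * x⌋₊ + 1) := by
      rw [integral_stepDensity_mul q hsupp b (hk0.trans hkx), hb _ (Nat.le_floor hkx)]
    have hbxm : Measurable fun t : ℝ => b (⌊t * x⌋₊ + 1) :=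
      hbm.comp (measurable_id.mul_const x)
    have hsi : IntegrableOn (stepDensity q x) (Ioo 0 1) :=
      Integrable.of_bound (measurable_stepDensity q x).aestronglyMeasurable x
        (ae_of_all _ fun t => by
          rw [Real.norm_eq_abs, abs_of_nonneg (stepDensity_nonneg q hx0.le t)]
          exact stepDensity_le q hx0.le t)
    have hmul : ∀ {f : ℝ → ℝ}, IntegrableOn f (Ioo 0 1) →
        IntegrableOn (fun t => f t * b (⌊t * x⌋₊ + 1)) (Ioo 0 1) := fun hf =>
      hf.mul_bdd (c := B) hbxm.aestronglyMeasurable (ae_of_all _ fun t => hB _)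
    have hL1 : ∫ t in Ioo (0 : ℝ) 1, |stepDensity q x t - p t| ≤ C * x ^ (-κ) := by
      have h1 := hqC x hCx
      have hd : IntegrableOn (fun t => stepDensity q x t - p t) (Ioo 0 1) :=
        hsi.sub hp.integrableOn
      rw [eLpNorm_one_eq_lintegral_enorm] at h1
      have h2 := integral_norm_eq_lintegral_enorm hd.aestronglyMeasurable
      simp only [Real.norm_eq_abs] at h2
      rw [h2]
      exact ENNReal.toReal_le_of_le_ofReal (by positivity) h1
    have hpow : x ^ (-κ) = Real.exp (-κ * s) := by
      rw [hx, ← Real.exp_mul, mul_comm]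
    simp only [← hx]
    rw [hint, hrec, ← integral_sub (hmul hsi) (hmul hp.integrableOn), ← hpow, mul_assoc]
    refine (abs_integral_le_integral_abs).trans ?_
    refine le_trans ?_ (mul_le_mul_of_nonneg_left hL1 hB0)
    rw [← integral_const_mul]
    refine integral_mono ((hmul hsi).sub (hmul hp.integrableOn)).abs
      ((hsi.sub hp.integrableOn).abs.const_mul B) fun t => ?_
    simp only [← sub_mul, abs_mul]
    rw [mul_comm]
    exact mul_le_mul_of_nonneg_right (hB _) (abs_nonneg _)
  obtain ⟨L, hL⟩ := hsol.exists_tendsto (hp.integrable_negLogLaw hlog)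
    (IsContinuousDensity.ae_pos_negLogLaw p) hc hαβ hlb
  -- Sampling at `s = log (n + 1)` gives `φ s = b (n + 2)`, hence the shift by two.
  refine ⟨L, (tendsto_add_atTop_iff_nat 2).1 ?_⟩
  have hlogn : Tendsto (fun n : ℕ => Real.log ((n : ℝ) + 1)) atTop atTop :=
    Real.tendsto_log_atTop.comp (tendsto_atTop_add_const_right _ _ tendsto_natCast_atTop_atTop)
  refine (hL.comp hlogn).congr fun n => ?_
  have h1 : Real.exp (Real.log ((n : ℝ) + 1)) = ((n + 1 : ℕ) : ℝ) := by
    rw [Real.exp_log (by positivity)]; push_cast; rfl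
  simp only [Function.comp_apply, h1, Nat.floor_natCast]

theorem mainTheorem3 (d : ℕ) (p : ℝ → ℝ) (hp : IsContinuousDensity p)
    (hlog : IntegrableOn (fun t => p t * Real.log (1 / t)) (Ioo 0 1))
    (q : ℕ → PMF ℕ) (hsupp : ∀ n : ℕ, 1 ≤ n → (q n).support ⊆ Set.Icc 1 n)
    (hq : StronglyDiscretizes q p)
    (k : ℕ) (hk : 1 ≤ k) (a : ℕ → EuclideanSpace ℝ (Fin d))
    (ha : ∀ n : ℕ, k ≤ n → a (n + 1) = ∑ j ∈ Finset.Icc 1 n, (q n j).toReal • a j) :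
    ∃ L : EuclideanSpace ℝ (Fin d), Tendsto a atTop (𝓝 L) := by
  have hcoord : ∀ i : Fin d, ∃ L, Tendsto (fun n => a n i) atTop (𝓝 L) := fun i =>
    exists_tendsto_of_averaging hp hlog hsupp hq hk fun n hn => by simp [ha n hn]
  choose L hL using hcoord
  refine ⟨WithLp.toLp 2 L, ?_⟩
  exact ((PiLp.continuous_toLp 2 _).tendsto L).comp (tendsto_pi_nhds.2 hL)
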